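/- All graphs are finite, simple and undirected, and $G[A]$ denotes the subgraph of $G$ induced by $A\subseteq V(G)$. A path $v_1,\dots,v_k$ of $G$ is a *triangle path* if $G$ has no edge $v_iv_j$ with $|j-i|>2$. A set $C\subseteq V(G)$ is *$t$-convex* in $G$ if it contains all vertices of every triangle path of $G$ joining two vertices of $C$. A set $S\subseteq V(G)$ is a *$t$-hull set* of $G$ if the smallest $t$-convex set of $G$ containing $S$ is $V(G)$. A *clique separator* of $G$ is a (possibly empty) clique $K$ such that $G-K$ is disconnected; a *$K$-component* of $G$ is then a subgraph $G[V(H)\cup K]$, where $H$ is a connected component of $G-K$. The graph $G$ is *reducible* if it has a clique separator, and *prime* otherwise. An *$mp$-subgraph* of $G$ is a maximal prime induced subgraph of $G$. Let $S\subseteq V(G)$ and let $F$ be an $mp$-subgraph of $G$. A vertex $v\in V(F)$ is a *pivot of $F$ via $F'$*, where $F'$ is an $mp$-subgraph of $G$ with $v\in V(F')$, if $K=V(F)\cap V(F')$ is a clique separator of $G$, $F'$ is contained in a $K$-component of $G$ that does not contain $F$, and this $K$-component contains a vertex of $S\setminus V(F)$. A vertex is a *pivot of $F$* if it is a pivot of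 $F$ via some $F'$. The set $S$ *satisfies* $F$ if at least one of the following holds: 1. there are two distinct pivots $u,v$ of $F$ such that $\{u,v\}$ is a $t$-hull set of the graph $F$; 2. there are an $mp$-subgraph $F'$ of $G$, a pivot $u$ of $F$ via $F'$, and a vertex $v\in S\cap(V(F)\setminus V(F'))$ such that $\{u,v\}$ is a $t$-hull set of $F$; 3. $S\cap V(F)$ is a $t$-hull set of $F$. **Theorem.** Let $G$ be a reducible graph and $S\subseteq V(G)$. Then $S$ is a $t$-hull set of $G$ if and only if $|S|\ge 2$ and $S$ satisfies every $mp$-subgraph of $G$. -/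

import Mathlib

namespace TConv

variable {V : Type*}

/-- A triangle path: a path `v₀, …, v_k` of `G` such that no edge of `G` joins `v_i` and `v_j`
whenever `|j - i| > 2`. -/
def IsTrianglePath (G : SimpleGraph V) {u v : V} (p : G.Walk u v) : Prop :=
  p.IsPath ∧ ∀ i j : ℕ, i + 2 < j → j ≤ p.length → ¬ G.Adj (p.getVert i) (p.getVert j)

/-- `C` is `t`-convex: it contains the vertices of every triangle path of `G` that joins two
vertices of `C`. -/
def IsTConvex (G : SimpleGraph V) (C : Set V) : Prop :=
  ∀ ⦃u v : V⦄, u ∈ C → v ∈ C → ∀ p : G.Walk u v, IsTrianglePath G p → ∀ x ∈ p.support, x ∈ C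

/-- The `t`-convex hull of `S`: the smallest `t`-convex set containing `S`. -/
def tHull (G : SimpleGraph V) (S : Set V) : Set V :=
  ⋂₀ {C : Set V | IsTConvex G C ∧ S ⊆ C}

theorem isLeast_tHull (G : SimpleGraph V) (S : Set V) :
    IsLeast {C : Set V | IsTConvex G C ∧ S ⊆ C} (tHull G S) := by
  refine ⟨⟨?_, ?_⟩, ?_⟩
  · intro u v hu hv p hp x hx C hC
    exact hC.1 (hu C hC) (hv C hC) p hp x hx
  · intro x hx C hC
    exact hC.2 hx
  · intro C hC
    exact Set.sInter_subset_of_mem hC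

/-- `S` is a `t`-hull set of `G`: its `t`-convex hull is the whole vertex set. -/
def IsTHullSet (G : SimpleGraph V) (S : Set V) : Prop :=
  tHull G S = Set.univ

/-- `T` is a `t`-hull set of the induced subgraph `G[F]` (used for `T ⊆ F`). The convexity is
that of the graph `G[F]`, not that of `G`. -/
def IsTHullSetOf (G : SimpleGraph V) (F T : Set V) : Prop :=
  T ⊆ F ∧ IsTHullSet (G.induce F) ((↑) ⁻¹' T : Set F)

/-- `K` is a separator of `G`: two vertices outside `K` are not joined by any path
avoiding `K`, that is, `G - K` is disconnected. -/
def IsSeparator (G : SimpleGraph V) (K : Set V) : Prop :=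
  ∃ a b : (Kᶜ : Set V), ¬ (G.induce Kᶜ).Reachable a b

/-- A separator that is a clique. -/
def IsCliqueSeparator (G : SimpleGraph V) (K : Set V) : Prop :=
  G.IsClique K ∧ IsSeparator G K

/-- A graph is reducible if it contains a clique separator. -/
def IsReducible (G : SimpleGraph V) : Prop :=
  ∃ K : Set V, IsCliqueSeparator G K

/-- A graph is prime if it is not reducible. -/
def IsPrime (G : SimpleGraph V) : Prop :=
  ¬ IsReducible G

/-- `F` is the vertex set of an `mp`-subgraph of `G`, that is, of a maximal prime induced
subgraph of `G`. (An induced subgraph is identified with its vertex set.) -/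
def IsMPSubgraph (G : SimpleGraph V) (F : Set V) : Prop :=
  Maximal (fun A : Set V => IsPrime (G.induce A)) F

/-- `A` is the vertex set of a `K`-component of `G`, where `K` is a clique separator of `G`:
`A = V(H) ∪ K` for a connected component `H` of `G - K`. -/
def IsSepComponent (G : SimpleGraph V) (K A : Set V) : Prop :=
  IsCliqueSeparator G K ∧
    ∃ H : (G.induce Kᶜ).ConnectedComponent, A = ((↑) '' H.supp : Set V) ∪ K

/-- The vertex `v` of `F` is a pivot of `F` (with respect to `S`), witnessed by the
`mp`-subgraph `F'`: `v` lies in `F'`, and some vertex of `S` outside `F` lies in the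
`(F ∩ F')`-component of `G` that contains `F'`, this being a component other than the one that
contains `F`. -/
def IsPivotVia (G : SimpleGraph V) (S F F' : Set V) (v : V) : Prop :=
  IsMPSubgraph G F' ∧ v ∈ F ∧ v ∈ F' ∧
    ∃ A : Set V, IsSepComponent G (F ∩ F') A ∧ F' ⊆ A ∧ ¬ F ⊆ A ∧ ∃ s ∈ S \ F, s ∈ A

/-- `v` is a pivot of `F` with respect to `S`. -/
def IsPivot (G : SimpleGraph V) (S F : Set V) (v : V) : Prop :=
  ∃ F' : Set V, IsPivotVia G S F F' v

/-- `S` satisfies the `mp`-subgraph `F` of `G`. -/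
def Satisfies (G : SimpleGraph V) (S F : Set V) : Prop :=
  (∃ u v : V, u ≠ v ∧ IsPivot G S F u ∧ IsPivot G S F v ∧ IsTHullSetOf G F {u, v}) ∨
  (∃ (F' : Set V) (u v : V), IsPivotVia G S F F' u ∧ v ∈ S ∩ (F \ F') ∧
    IsTHullSetOf G F {u, v}) ∨
  IsTHullSetOf G F (S ∩ F)

end TConv

namespace TConv

variable {V : Type*}

/-! Necessity. For an mp-subgraph `F`, each component of `G - F` attaches to `F` in a clique
(`attach_of_mp`), so a relatively convex `D ⊆ F` extends to a convex set of `G` by adding the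
components attached only to `D` (`isTConvex_extend`). Hence, if `S` generates `G`, then `S ∩ F` and
the attachments of components meeting `S` generate `F`. These attachments are pivots
(`isPivot_of_mem_attach`), and in a prime graph a nontrivial generating set contains a generating
pair (`PrimeSet.exists_pair`); sorting the pair by type gives the three alternatives. Also `|S| ≥
2`, because sets with at most one element are convex.

Sufficiency. If a convex `C ⊇ S` is proper, a component `L` of `G - C` attaches to `C` in a clique
`Q`, and some mp-subgraph `F` with `Q ⊆ F ⊆ L ∪ Q` meets `L`. All pivots of `F` lie in `C`, so each
alternative would generate `F` from inside `C ∩ F`, which is relatively convex and proper. -/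

/-- `X` is closed under taking neighbours inside `W`. -/
def ClosedIn (G : SimpleGraph V) (W X : Set V) : Prop :=
  ∀ x ∈ X, ∀ y ∈ W, G.Adj x y → y ∈ X

/-- `G[W]` is preconnected: no nonempty proper subset of `W` is closed under taking neighbours. -/
def IsConn (G : SimpleGraph V) (W : Set V) : Prop :=
  ∀ X ⊆ W, X.Nonempty → ClosedIn G W X → W ⊆ X

/-- The vertices of `W` that are connected to `a` inside `W`. -/
def comp (G : SimpleGraph V) (W : Set V) (a : V) : Set V :=
  ⋂₀ {X : Set V | a ∈ X ∧ ClosedIn G W X}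

/-- The vertices of `F` with a neighbour in `H`. -/
def attach (G : SimpleGraph V) (F H : Set V) : Set V :=
  {f ∈ F | ∃ h ∈ H, G.Adj h f}

/-- Primality of `G[F]`: deleting a clique never disconnects it. -/
def PrimeSet (G : SimpleGraph V) (F : Set V) : Prop :=
  ∀ Q ⊆ F, G.IsClique Q → IsConn G (F \ Q)

/-- A description of the `t`-convex sets of `G[F]`: a vertex outside `D` has at most one
neighbour in `D`, and the attachments in `D` of a connected set outside `D` form a clique. -/
structure RelConvex (G : SimpleGraph V) (F D : Set V) : Prop where
  subset : D ⊆ F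
  nbr : ∀ x ∈ F \ D, ∀ a ∈ D, ∀ b ∈ D, G.Adj x a → G.Adj x b → a = b
  isClique : ∀ L ⊆ F \ D, IsConn G L → G.IsClique (attach G D L)

/-! ### Connectedness by closed sets, and its translation to induced subgraphs. -/

section Connectivity

variable {G : SimpleGraph V} {W X Y : Set V} {a b : V}

theorem mem_comp_self : a ∈ comp G W a := fun _ hX => hX.1

theorem closedIn_comp : ClosedIn G W (comp G W a) :=
  fun x hx y hy h X hX => hX.2 x (hx X hX) y hy h

theorem comp_subset_of_closedIn (ha : a ∈ X) (hX : ClosedIn G W X) : comp G W a ⊆ X :=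
  Set.sInter_subset_of_mem ⟨ha, hX⟩

theorem comp_subset (ha : a ∈ W) : comp G W a ⊆ W :=
  comp_subset_of_closedIn ha fun _ _ _ hy _ => hy

theorem isConn_comp (ha : a ∈ W) : IsConn G (comp G W a) := by
  intro X hX hne hcl
  have hsub := comp_subset (G := G) ha
  by_cases haX : a ∈ X
  · refine comp_subset_of_closedIn haX fun x hx y hy h => ?_
    exact hcl x hx y (closedIn_comp x (hX hx) y hy h) h
  · exfalso
    have : comp G W a ⊆ comp G W a \ X := by
      refine comp_subset_of_closedIn ⟨mem_comp_self, haX⟩ fun x hx y hy h => ?_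
      have hyc := closedIn_comp x hx.1 y hy h
      exact ⟨hyc, fun hyX => hx.2 (hcl y hyX x hx.1 h.symm)⟩
    obtain ⟨x, hx⟩ := hne
    exact (this (hX hx)).2 hx

theorem comp_eq_of_mem (ha : a ∈ W) (hb : b ∈ comp G W a) : comp G W b = comp G W a := by
  have h1 : comp G W b ⊆ comp G W a := comp_subset_of_closedIn hb closedIn_comp
  refine h1.antisymm ?_
  refine isConn_comp ha _ h1 ⟨b, mem_comp_self⟩ fun x hx y hy h => ?_
  exact closedIn_comp x hx y (comp_subset ha hy) h

theorem comp_eq_of_adj (ha : a ∈ W) (hb : b ∈ W) (h : G.Adj a b) : comp G W a = comp G W b :=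
  (comp_eq_of_mem ha (closedIn_comp a mem_comp_self b hb h)).symm

theorem IsConn.subset_or_subset (hW : IsConn G W) (hsub : W ⊆ X ∪ Y)
    (hXY : ∀ x ∈ X, ∀ y ∈ Y, ¬ G.Adj x y) : W ⊆ X ∨ W ⊆ Y := by
  by_cases h : (W ∩ X).Nonempty
  · left
    refine (hW _ Set.inter_subset_left h fun x hx y hy hxy => ⟨hy, ?_⟩).trans
      Set.inter_subset_right
    exact (hsub hy).resolve_right fun hyY => hXY x hx.2 y hyY hxy
  · right
    exact fun x hx => (hsub hx).resolve_left fun hxX => h ⟨x, hx, hxX⟩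

theorem isConn_iff_mem_comp : IsConn G W ↔ ∀ a ∈ W, ∀ b ∈ W, b ∈ comp G W a := by
  refine ⟨fun h a ha b hb => h _ (comp_subset ha) ⟨a, mem_comp_self⟩ closedIn_comp hb, ?_⟩
  rintro h X hX ⟨a, ha⟩ hcl b hb
  exact comp_subset_of_closedIn ha hcl (h a (hX ha) b hb)

theorem reachable_induce_iff (a b : W) : (G.induce W).Reachable a b ↔ (b : V) ∈ comp G W a := by
  constructor
  · rintro ⟨p⟩
    induction p with
    | nil => exact mem_comp_self
    | @cons u v w h p ih =>
      rw [comp_eq_of_adj u.2 v.2 h]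
      exact ih
  · intro h
    have := comp_subset_of_closedIn (G := G) (W := W) (a := (a : V))
      (X := {y | ∃ hy : y ∈ W, (G.induce W).Reachable a ⟨y, hy⟩}) ⟨a.2, SimpleGraph.Reachable.refl _⟩
      (by
        rintro x ⟨hx, hax⟩ y hy hxy
        refine ⟨hy, hax.trans (SimpleGraph.Adj.reachable ?_)⟩
        exact hxy)
    exact (this h).2

theorem image_supp_connectedComponentMk (a : W) :
    ((↑) '' ((G.induce W).connectedComponentMk a).supp : Set V) = comp G W a := by
  ext y
  simp only [Set.mem_image, SimpleGraph.ConnectedComponent.mem_supp_iff,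
    SimpleGraph.ConnectedComponent.eq]
  constructor
  · rintro ⟨x, hx, rfl⟩
    exact (reachable_induce_iff a x).1 hx.symm
  · intro hy
    exact ⟨⟨y, comp_subset a.2 hy⟩, ((reachable_induce_iff a ⟨y, comp_subset a.2 hy⟩).2 hy).symm, rfl⟩

theorem isSeparator_iff : IsSeparator G W ↔ ¬ IsConn G Wᶜ := by
  rw [isConn_iff_mem_comp, IsSeparator]
  push Not
  constructor
  · rintro ⟨a, b, h⟩
    exact ⟨a, a.2, b, b.2, fun hb => h ((reachable_induce_iff a b).2 hb)⟩
  · rintro ⟨a, ha, b, hb, h⟩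
    exact ⟨⟨a, ha⟩, ⟨b, hb⟩, fun hr => h ((reachable_induce_iff (W := Wᶜ) ⟨a, ha⟩ ⟨b, hb⟩).1 hr)⟩

theorem isConn_induce_iff {F : Set V} (X : Set F) :
    IsConn (G.induce F) X ↔ IsConn G ((↑) '' X : Set V) := by
  constructor
  · rintro h Y hY ⟨y, hy⟩ hcl _ ⟨x, hx, rfl⟩
    obtain ⟨y', hy', rfl⟩ := hY hy
    refine h {z | (z : V) ∈ Y} ?_ ⟨y', hy⟩ (fun a ha b hb hab => ?_) hx
    · intro z hz
      obtain ⟨z', hz', e⟩ := hY hz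
      rwa [← Subtype.ext e]
    · exact hcl a ha b ⟨b, hb, rfl⟩ hab
  · rintro h Y hY ⟨y, hy⟩ hcl x hx
    have := h ((↑) '' Y) (Set.image_mono hY) ⟨y, y, hy, rfl⟩ ?_ ⟨x, hx, rfl⟩
    · obtain ⟨x', hx', e⟩ := this
      rwa [← Subtype.ext e]
    · rintro _ ⟨a, ha, rfl⟩ _ ⟨b, hb, rfl⟩ hab
      exact ⟨b, hcl a ha b hb hab, rfl⟩

theorem isClique_induce_iff {F : Set V} (X : Set F) :
    (G.induce F).IsClique X ↔ G.IsClique ((↑) '' X : Set V) := by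
  constructor
  · rintro h _ ⟨a, ha, rfl⟩ _ ⟨b, hb, rfl⟩ hab
    exact h ha hb fun e => hab (congrArg _ e)
  · intro h a ha b hb hab
    exact h ⟨a, ha, rfl⟩ ⟨b, hb, rfl⟩ fun e => hab (Subtype.ext e)

theorem isPrime_induce_iff {F : Set V} : IsPrime (G.induce F) ↔ PrimeSet G F := by
  have key : ∀ K : Set F, ((↑) '' Kᶜ : Set V) = F \ ((↑) '' K) := fun K => by
    ext x; simp
  constructor
  · intro h Q hQ hcl
    by_contra hcon
    have hQ' : ((↑) '' ((↑) ⁻¹' Q : Set F) : Set V) = Q := by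
      rw [Subtype.image_preimage_coe]; exact Set.inter_eq_right.2 hQ
    refine h ⟨(↑) ⁻¹' Q, (isClique_induce_iff _).2 (by rwa [hQ']), isSeparator_iff.2 ?_⟩
    rwa [isConn_induce_iff, key, hQ']
  · rintro h ⟨K, hK, hs⟩
    rw [isSeparator_iff, isConn_induce_iff, key] at hs
    refine hs (h _ ?_ ((isClique_induce_iff _).1 hK))
    rintro _ ⟨x, _, rfl⟩
    exact x.2

theorem isMPSubgraph_iff {F : Set V} : IsMPSubgraph G F ↔ Maximal (PrimeSet G) F := by
  unfold IsMPSubgraph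
  simp only [isPrime_induce_iff]

end Connectivity

/-! ### Prime sets and the attachments of mp-subgraphs. -/

section Prime

variable {G : SimpleGraph V} {F H K Q : Set V}

theorem PrimeSet.diff_isConn (hF : PrimeSet G F) (hQ : G.IsClique Q) : IsConn G (F \ Q) := by
  rw [← Set.sdiff_inter_self_eq_sdiff]
  exact hF _ Set.inter_subset_right (hQ.subset Set.inter_subset_left)

theorem _root_.SimpleGraph.IsClique.primeSet (hK : G.IsClique K) : PrimeSet G K := by
  rintro Q - - X hX ⟨x, hx⟩ hcl y hy
  by_cases h : x = y
  · exact h ▸ hx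
  · exact hcl x hx y hy (hK (hX hx).1 hy.1 h)

/-- A prime induced subgraph meeting a union `H` of components of `G - K` lies in `H ∪ K`. -/
theorem PrimeSet.subset_union (hF : PrimeSet G F) (hK : G.IsClique K) (hFH : (F ∩ H).Nonempty)
    (hHK : Disjoint H K) (hH : ∀ h ∈ H, ∀ y, G.Adj h y → y ∈ H ∪ K) : F ⊆ H ∪ K := by
  have := hF.diff_isConn hK (F ∩ H) (fun x hx => ⟨hx.1, Set.disjoint_left.1 hHK hx.2⟩) hFH
    fun x hx y hy hxy => ⟨hy.1, (hH x hx.2 y hxy).resolve_right hy.2⟩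
  intro x hx
  by_cases hxK : x ∈ K
  · exact Or.inr hxK
  · exact Or.inl (this ⟨hx, hxK⟩).2

/-- Vertices of `H \ Y` with a neighbour in `Y` lie in `Q`, hence equal or are adjacent to `q`; any
detour through `Y` can be replaced by one through `q`. -/
theorem IsConn.diff_of_clique_separation {X Y : Set V} (hH : IsConn G H) (hQ : G.IsClique Q)
    {q : V} (hqQ : q ∈ Q) (hqH : q ∈ H) (hqY : q ∉ Y)
    (hY : ∀ h ∈ H, h ∉ Q → h ∉ Y → h ∈ X) (hXY : ∀ x ∈ X, ∀ y ∈ Y, ¬ G.Adj x y) :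
    IsConn G (H \ Y) := by
  intro Z hZ hne hcl
  by_cases hqZ : q ∈ Z
  · have h1 : H ⊆ Z ∪ (H ∩ Y) := by
      refine hH _ (Set.union_subset (hZ.trans Set.sdiff_subset) Set.inter_subset_left)
        ⟨q, Or.inl hqZ⟩ ?_
      rintro x (hx | hx) y hy hxy
      · by_cases hyY : y ∈ Y
        · exact Or.inr ⟨hy, hyY⟩
        · exact Or.inl (hcl x hx y ⟨hy, hyY⟩ hxy)
      · by_cases hyY : y ∈ Y
        · exact Or.inr ⟨hy, hyY⟩
        · left
          by_cases hyQ : y ∈ Q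
          · by_cases e : q = y
            · exact e ▸ hqZ
            · exact hcl q hqZ y ⟨hy, hyY⟩ (hQ hqQ hyQ e)
          · exact absurd hxy.symm (hXY y (hY y hy hyQ hyY) x hx.2)
    exact fun x hx => (h1 hx.1).resolve_right fun h => hx.2 h.2
  · exfalso
    refine hqZ (hH Z (hZ.trans Set.sdiff_subset) hne (fun z hz y hy hzy => ?_) hqH)
    by_cases hyY : y ∈ Y
    · exfalso
      by_cases hzQ : z ∈ Q
      · have e : z ≠ q := fun e => hqZ (e ▸ hz)
        exact hqZ (hcl z hz q ⟨hqH, hqY⟩ (hQ hzQ hqQ e))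
      · exact hXY z (hY z (hZ hz).1 hzQ (hZ hz).2) y hyY hzy
    · exact hcl z hz y ⟨hy, hyY⟩ hzy

/-- A prime set `F` can be enlarged to a prime set inside `F ∪ H`, provided that `H` is connected
and its attachments are not contained in a clique that is a proper subset of `F`. -/
theorem PrimeSet.exists_union [Finite V] (hF : PrimeSet G F) {T : Set V} (hTF : T ⊆ F)
    (hT : ∀ Q ⊆ F, G.IsClique Q → T ⊆ Q → Q = F) (hne : H.Nonempty) (hH : IsConn G H)
    (hFH : Disjoint F H) (hTH : ∀ t ∈ T, ∃ h ∈ H, G.Adj t h) :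
    ∃ H' ⊆ H, H'.Nonempty ∧ PrimeSet G (F ∪ H') := by
  -- A minimal connected set that still touches all of `T` is the right extension.
  obtain ⟨M, hMH, hM⟩ := (Set.toFinite {M : Set V | M.Nonempty ∧ IsConn G M ∧
    ∀ t ∈ T, ∃ h ∈ M, G.Adj t h}).exists_le_minimal (a := H) ⟨hne, hH, hTH⟩
  obtain ⟨⟨hMne, hMc, hMT⟩, hmin⟩ := hM
  have hFM : Disjoint F M := hFH.mono_right hMH
  refine ⟨M, hMH, hMne, fun Q hQ hQc X hX hXne hcl => ?_⟩
  by_contra hcon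
  -- `Y` is the side of the split contained in `M`. If `Q` meets `M`, then `M \ Y` contradicts
  -- minimality; otherwise `M` lies on one side, and `M ⊆ Y` forces `T ⊆ Q`, so `Q = F` and `X` is
  -- empty.
  have main : ∀ X Y : Set V, X.Nonempty → Y.Nonempty → Disjoint X Y → X ∪ Y = (F ∪ M) \ Q →
      (∀ x ∈ X, ∀ y ∈ Y, ¬ G.Adj x y) → F \ Q ⊆ X → False := by
    intro X Y hXne hYne hd hun hXY hFX
    have hYsub : Y ⊆ (F ∪ M) \ Q := hun ▸ Set.subset_union_right
    have hXsub : X ⊆ (F ∪ M) \ Q := hun ▸ Set.subset_union_left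
    have hYM : Y ⊆ M := fun y hy => (hYsub hy).1.resolve_left fun hyF =>
      Set.disjoint_left.1 hd (hFX ⟨hyF, (hYsub hy).2⟩) hy
    by_cases hq : (Q ∩ M).Nonempty
    · obtain ⟨q, hqQ, hqM⟩ := hq
      have hqY : q ∉ Y := fun h => (hYsub h).2 hqQ
      have hc : IsConn G (M \ Y) := hMc.diff_of_clique_separation hQc hqQ hqM hqY
        (fun h hh hhQ hhY => (hun.ge ⟨Or.inr hh, hhQ⟩).resolve_right hhY) hXY
      obtain ⟨y, hy⟩ := hYne
      suffices hT' : ∀ t ∈ T, ∃ h ∈ M \ Y, G.Adj t h from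
        (hmin (y := M \ Y) ⟨⟨q, hqM, hqY⟩, hc, hT'⟩ Set.sdiff_subset (hYM hy)).2 hy
      intro t ht
      obtain ⟨h, hh, hth⟩ := hMT t ht
      by_cases hhY : h ∈ Y
      · by_cases htQ : t ∈ Q
        · refine ⟨q, ⟨hqM, hqY⟩, hQc htQ hqQ ?_⟩
          rintro rfl
          exact Set.disjoint_left.1 hFM (hTF ht) hqM
        · exact absurd hth (hXY t (hFX ⟨hTF ht, htQ⟩) h hhY)
      · exact ⟨h, ⟨hh, hhY⟩, hth⟩
    · have hQM : ∀ m ∈ M, m ∉ Q := fun m hm hmQ => hq ⟨m, hmQ, hm⟩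
      have hQF : Q ⊆ F := fun x hx => (hQ hx).resolve_right fun h => hQM x h hx
      rcases hMc.subset_or_subset (fun m hm => hun.ge ⟨Or.inr hm, hQM m hm⟩) hXY with h | h
      · obtain ⟨y, hy⟩ := hYne
        exact Set.disjoint_left.1 hd (h (hYM hy)) hy
      · have hTQ : T ⊆ Q := by
          intro t ht
          by_contra htQ
          obtain ⟨m, hm, htm⟩ := hMT t ht
          exact hXY t (hFX ⟨hTF ht, htQ⟩) m (h hm) htm
        obtain ⟨x, hx⟩ := hXne
        have hxM : x ∈ M := (hXsub hx).1.resolve_left fun hxF =>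
          (hXsub hx).2 (by rwa [hT Q hQF hQc hTQ])
        exact Set.disjoint_left.1 hd hx (h hxM)
  have hYne : (((F ∪ M) \ Q) \ X).Nonempty := Set.sdiff_nonempty.2 hcon
  have hXY : ∀ x ∈ X, ∀ y ∈ ((F ∪ M) \ Q) \ X, ¬ G.Adj x y :=
    fun x hx y hy h => hy.2 (hcl x hx y hy.1 h)
  have hun : X ∪ (((F ∪ M) \ Q) \ X) = (F ∪ M) \ Q := Set.union_sdiff_cancel hX
  rcases (hF.diff_isConn hQc).subset_or_subset
    (fun x hx => hun.ge ⟨Or.inl hx.1, hx.2⟩) hXY with h | h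
  · exact main _ _ hXne hYne Set.disjoint_sdiff_right hun hXY h
  · exact main _ _ hYne hXne Set.disjoint_sdiff_left (by rw [Set.union_comm]; exact hun)
      (fun x hx y hy hxy => hXY y hy x hx hxy.symm) h

theorem exists_mp_superset [Finite V] (hF : PrimeSet G F) :
    ∃ F', F ⊆ F' ∧ Maximal (PrimeSet G) F' :=
  (Set.toFinite {A | PrimeSet G A}).exists_le_maximal hF

/-- Otherwise `PrimeSet.exists_union` would enlarge `F` to a bigger prime set. -/
theorem attach_of_mp [Finite V] (hF : Maximal (PrimeSet G) F) (hne : H.Nonempty)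
    (hH : IsConn G H) (hFH : Disjoint F H) :
    G.IsClique (attach G F H) ∧ (F \ attach G F H).Nonempty := by
  by_cases hT : ∀ Q ⊆ F, G.IsClique Q → attach G F H ⊆ Q → Q = F
  · exfalso
    obtain ⟨H', hH', ⟨x, hx⟩, hp⟩ := hF.1.exists_union (T := attach G F H) (fun _ h => h.1) hT
      hne hH hFH fun t ht => by
        obtain ⟨h, hh, e⟩ := ht.2
        exact ⟨h, hh, e.symm⟩
    exact Set.disjoint_left.1 hFH (hF.2 hp Set.subset_union_left (Or.inr hx)) (hH' hx)
  · push Not at hT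
    obtain ⟨Q, hQF, hQ, hTQ, hne'⟩ := hT
    refine ⟨hQ.subset hTQ, Set.sdiff_nonempty.2 fun h => hne' (hQF.antisymm (h.trans hTQ))⟩

/-- If `H` is a connected set whose neighbourhood is a clique `K`, then some `mp`-subgraph
contains `K`, meets `H` and lies in `H ∪ K`. -/
theorem exists_mp_between [Finite V] (hK : G.IsClique K) (hne : H.Nonempty) (hH : IsConn G H)
    (hHK : Disjoint H K) (hN : ∀ h ∈ H, ∀ y, G.Adj h y → y ∈ H ∪ K)
    (hfull : ∀ k ∈ K, ∃ h ∈ H, G.Adj k h) :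
    ∃ F, Maximal (PrimeSet G) F ∧ K ⊆ F ∧ F ⊆ H ∪ K ∧ (F ∩ H).Nonempty := by
  obtain ⟨H', hH', ⟨x, hx⟩, hp⟩ := hK.primeSet.exists_union (T := K) subset_rfl
    (fun Q hQ _ h => hQ.antisymm h) hne hH hHK.symm hfull
  obtain ⟨F, hF, hmax⟩ := exists_mp_superset hp
  have hFH : (F ∩ H).Nonempty := ⟨x, hF (Or.inr hx), hH' hx⟩
  exact ⟨F, hmax, Set.subset_union_left.trans hF, hmax.1.subset_union hK hFH hHK hN, hFH⟩

theorem neighbor_comp_compl {a x y : V} (hx : x ∈ comp G Fᶜ a) (hxy : G.Adj x y) :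
    y ∈ comp G Fᶜ a ∪ attach G F (comp G Fᶜ a) := by
  by_cases hy : y ∈ F
  · exact Or.inr ⟨hy, x, hx, hxy⟩
  · exact Or.inl (closedIn_comp x hx y hy hxy)

theorem disjoint_comp_compl {a : V} (ha : a ∉ F) : Disjoint F (comp G Fᶜ a) :=
  Set.disjoint_left.2 fun _ hx hc => comp_subset (W := Fᶜ) ha hc hx

end Prime

/-! ### Convex sets of `G` and of its prime subgraphs. -/

section Convex

variable {G : SimpleGraph V} {C F D : Set V}

theorem IsTConvex.eq_of_adj (hC : IsTConvex G C) {x a b : V} (hx : x ∉ C) (ha : a ∈ C)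
    (hb : b ∈ C) (hxa : G.Adj x a) (hxb : G.Adj x b) : a = b := by
  by_contra hab
  refine hx (hC ha hb (.cons hxa.symm (.cons hxb .nil)) ⟨?_, ?_⟩ x (by simp))
  · simp [hxa.ne', hxb.ne, hab]
  · intro i j hij hj
    simp at hj
    omega

theorem exists_chordless_path {L : Set V} (hL : IsConn G L) {a b x y : V} (hx : x ∈ L)
    (hy : y ∈ L) (hax : G.Adj a x) (hby : G.Adj b y) :
    ∃ p : G.Walk a b, p.IsPath ∧ (∀ z ∈ p.support, z ∈ insert a (insert b L)) ∧
      ∀ i j : ℕ, i + 1 < j → j ≤ p.length → ¬ G.Adj (p.getVert i) (p.getVert j) := by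
  set W : Set V := insert a (insert b L)
  have haW : a ∈ W := Or.inl rfl
  have hbW : b ∈ W := Or.inr (Or.inl rfl)
  have hLW : L ⊆ W := fun z hz => Or.inr (Or.inr hz)
  have hr : (G.induce W).Reachable ⟨a, haW⟩ ⟨b, hbW⟩ := by
    rw [reachable_induce_iff]
    have h1 : x ∈ comp G W a := closedIn_comp a mem_comp_self x (hLW hx) hax
    have h2 : L ⊆ L ∩ comp G W a := hL _ Set.inter_subset_left ⟨x, hx, h1⟩
      fun u hu v hv huv => ⟨hv, closedIn_comp u hu.2 v (hLW hv) huv⟩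
    exact closedIn_comp y (h2 hy).2 b hbW hby.symm
  obtain ⟨q, hq, hlen⟩ := hr.exists_path_of_dist
  let f : G.induce W →g G := (SimpleGraph.Embedding.induce W).toHom
  suffices ∃ p : G.Walk (f ⟨a, haW⟩) (f ⟨b, hbW⟩), p.IsPath ∧ (∀ z ∈ p.support, z ∈ W) ∧
      ∀ i j : ℕ, i + 1 < j → j ≤ p.length → ¬ G.Adj (p.getVert i) (p.getVert j) from this
  refine ⟨q.map f, hq.map Subtype.val_injective, ?_, ?_⟩
  · intro z hz
    rw [SimpleGraph.Walk.support_map, List.mem_map] at hz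
    obtain ⟨w, _, rfl⟩ := hz
    exact w.2
  · intro i j hij hj hadj
    rw [SimpleGraph.Walk.length_map] at hj
    rw [SimpleGraph.Walk.getVert_map, SimpleGraph.Walk.getVert_map] at hadj
    have hadj' : (G.induce W).Adj (q.getVert i) (q.getVert j) := hadj
    -- A chord would shortcut the shortest path `q`.
    have := SimpleGraph.dist_le ((q.take i).append (.cons hadj' (q.drop j)))
    simp only [SimpleGraph.Walk.length_append, SimpleGraph.Walk.length_cons,
      SimpleGraph.Walk.take_length, SimpleGraph.Walk.drop_length] at this
    omega

/-- For nonadjacent attachments, the second vertex of a chordless path through `L` would lie in both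
`L` and `C`. -/
theorem IsTConvex.isClique_attach (hC : IsTConvex G C) {L : Set V} (hL : IsConn G L)
    (hLC : Disjoint L C) : G.IsClique (attach G C L) := by
  rintro a ⟨ha, x, hx, hxa⟩ b ⟨hb, y, hy, hyb⟩ hab
  by_contra hnadj
  obtain ⟨p, hp, hsupp, hch⟩ := exists_chordless_path hL hx hy hxa.symm hyb.symm
  have hall := hC ha hb p ⟨hp, fun i j hij => hch i j (by omega)⟩
  cases p with
  | nil => exact hab rfl
  | @cons _ c _ h p =>
    have hc : c ∈ (SimpleGraph.Walk.cons h p).support := by simp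
    rcases hsupp c hc with e | e | e
    · exact h.ne e.symm
    · exact hnadj (e ▸ h)
    · exact Set.disjoint_left.1 hLC e (hall c hc)

/-- A criterion for `t`-convexity in terms of a function that is constant on the components
of `G - C`. -/
theorem isTConvex_of_label {α : Type*} (l : V → α)
    (hnbr : ∀ x ∉ C, ∀ a ∈ C, ∀ b ∈ C, G.Adj x a → G.Adj x b → a = b)
    (hl : ∀ x ∉ C, ∀ y ∉ C, G.Adj x y → l x = l y)
    (hat : ∀ a ∈ C, ∀ b ∈ C, ∀ x ∉ C, ∀ y ∉ C, G.Adj a x → G.Adj b y → l x = l y → a ≠ b →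
      G.Adj a b) : IsTConvex G C := by
  classical
  intro u v hu hv p hp x hx
  by_contra hxC
  obtain ⟨k, rfl, hk⟩ := SimpleGraph.Walk.mem_support_iff_exists_getVert.1 hx
  -- Find the vertices of `C` on the path nearest to `x` on either side.
  have hlow : ∃ i, i ≤ k ∧ p.getVert (k - i) ∈ C := ⟨k, le_rfl, by simpa using hu⟩
  have hupp : ∃ i, k + i ≤ p.length ∧ p.getVert (k + i) ∈ C :=
    ⟨p.length - k, by omega, by rw [show k + (p.length - k) = p.length by omega]; simpa using hv⟩
  obtain ⟨hi1, hi2⟩ := Nat.find_spec hlow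
  obtain ⟨hj1, hj2⟩ := Nat.find_spec hupp
  have hiM := fun m => Nat.find_min hlow (m := m)
  have hjM := fun m => Nat.find_min hupp (m := m)
  generalize Nat.find hlow = i at *
  generalize Nat.find hupp = j at *
  have hi0 : i ≠ 0 := by rintro rfl; exact hxC (by simpa using hi2)
  have hj0 : j ≠ 0 := by rintro rfl; exact hxC (by simpa using hj2)
  have hout : ∀ m, k - i < m → m < k + j → p.getVert m ∉ C := by
    intro m h1 h2 hm
    rcases le_total m k with h | h
    · exact hiM (k - m) (by omega) ⟨by omega, by rwa [show k - (k - m) = m by omega]⟩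
    · exact hjM (m - k) (by omega) ⟨by omega, by rwa [show k + (m - k) = m by omega]⟩
  have hlab : ∀ m, k - i + 1 + m < k + j →
      l (p.getVert (k - i + 1)) = l (p.getVert (k - i + 1 + m)) := by
    intro m
    induction m with
    | zero => intro _; rfl
    | succ m ih =>
      intro hm
      rw [ih (by omega)]
      exact hl _ (hout _ (by omega) (by omega)) _ (hout _ (by omega) (by omega))
        (p.adj_getVert_succ (by omega))
  have hinj := hp.1.getVert_injOn
  have hne : p.getVert (k - i) ≠ p.getVert (k + j) := by
    intro e
    have := hinj (show k - i ≤ p.length by omega) hj1 e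
    omega
  have e1 : G.Adj (p.getVert (k - i)) (p.getVert (k - i + 1)) := p.adj_getVert_succ (by omega)
  have e2 : G.Adj (p.getVert (k + j - 1)) (p.getVert (k + j)) := by
    have := p.adj_getVert_succ (i := k + j - 1) (by omega)
    rwa [show k + j - 1 + 1 = k + j by omega] at this
  have hadj : G.Adj (p.getVert (k - i)) (p.getVert (k + j)) := by
    refine hat _ hi2 _ hj2 _ (hout _ (by omega) (by omega)) _
      (hout (k + j - 1) (by omega) (by omega)) e1 e2.symm ?_ hne
    have := hlab (k + j - 1 - (k - i + 1)) (by omega)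
    rwa [show k - i + 1 + (k + j - 1 - (k - i + 1)) = k + j - 1 by omega] at this
  -- These two are adjacent, so on a triangle path only `x` lies between them, against `hnbr`.
  have hd : ¬ (k - i + 2 < k + j) := fun h => hp.2 _ _ h hj1 hadj
  have hk1 : k - i + 1 = k := by omega
  have hk2 : k + j - 1 = k := by omega
  rw [hk1] at e1
  rw [hk2] at e2
  exact hne (hnbr _ hxC _ hi2 _ hj2 e1.symm e2)

theorem IsTConvex.relConvex_inter (hC : IsTConvex G C) (F : Set V) : RelConvex G F (C ∩ F) where
  subset := Set.inter_subset_right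
  nbr x hx a ha b hb hxa hxb := hC.eq_of_adj (fun h => hx.2 ⟨h, hx.1⟩) ha.1 hb.1 hxa hxb
  isClique L hL hc := by
    have hsub : attach G (C ∩ F) L ⊆ attach G C L := fun a ha => ⟨ha.1.1, ha.2⟩
    exact (hC.isClique_attach hc (Set.disjoint_left.2 fun x hx h =>
      (hL hx).2 ⟨h, (hL hx).1⟩)).subset hsub

theorem isTConvex_induce_iff (hD : D ⊆ F) :
    IsTConvex (G.induce F) ((↑) ⁻¹' D) ↔ RelConvex G F D := by
  constructor
  · intro h
    refine ⟨hD, fun x hx a ha b hb hxa hxb => ?_, ?_⟩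
    · exact congrArg Subtype.val (h.eq_of_adj (x := ⟨x, hx.1⟩) (a := ⟨a, hD ha⟩)
        (b := ⟨b, hD hb⟩) hx.2 ha hb hxa hxb)
    · intro L hL hc
      have hL' : ((↑) '' ((↑) ⁻¹' L : Set F) : Set V) = L := by
        rw [Subtype.image_preimage_coe]
        exact Set.inter_eq_right.2 fun x hx => (hL hx).1
      have := h.isClique_attach (L := (↑) ⁻¹' L) ((isConn_induce_iff _).2 (by rwa [hL']))
        (Set.disjoint_left.2 fun x hx hx' => (hL hx).2 hx')
      rintro a ⟨ha, x, hx, hxa⟩ b ⟨hb, y, hy, hyb⟩ hab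
      exact this (x := ⟨a, hD ha⟩) ⟨ha, ⟨x, (hL hx).1⟩, hx, hxa⟩ (y := ⟨b, hD hb⟩)
        ⟨hb, ⟨y, (hL hy).1⟩, hy, hyb⟩ fun e => hab (congrArg Subtype.val e)
  · intro h
    refine isTConvex_of_label (fun x : F => comp G (F \ D) x) ?_ ?_ ?_
    · exact fun x hx a ha b hb hxa hxb => Subtype.ext (h.nbr x ⟨x.2, hx⟩ a ha b hb hxa hxb)
    · exact fun x hx y hy hxy => comp_eq_of_adj ⟨x.2, hx⟩ ⟨y.2, hy⟩ hxy
    · intro a ha b hb x hx y hy hax hby e hab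
      have hxF : (x : V) ∈ F \ D := ⟨x.2, hx⟩
      refine h.isClique (comp G (F \ D) x) (comp_subset hxF) (isConn_comp hxF)
        ⟨ha, x, mem_comp_self, hax.symm⟩ ⟨hb, y, ?_, hby.symm⟩ fun e => hab (Subtype.ext e)
      rw [e]
      exact mem_comp_self

theorem isTHullSet_iff {S : Set V} :
    IsTHullSet G S ↔ ∀ C, IsTConvex G C → S ⊆ C → ∀ x, x ∈ C := by
  simp only [IsTHullSet, tHull, Set.eq_univ_iff_forall, Set.mem_sInter, Set.mem_ofPred_eq, and_imp]
  exact ⟨fun h C hC hS x => h x C hC hS, fun h x C hC hS => h C hC hS x⟩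

theorem isTHullSetOf_iff {T : Set V} :
    IsTHullSetOf G F T ↔ T ⊆ F ∧ ∀ D, RelConvex G F D → T ⊆ D → F ⊆ D := by
  rw [IsTHullSetOf, isTHullSet_iff]
  refine and_congr_right fun hTF => ⟨fun h D hD hTD x hx => ?_, fun h C hC hTC x => ?_⟩
  · exact h _ ((isTConvex_induce_iff hD.subset).2 hD) (fun y hy => hTD hy) ⟨x, hx⟩
  · have hsub : ((↑) '' C : Set V) ⊆ F := by
      rintro _ ⟨y, _, rfl⟩
      exact y.2
    have hpre : ((↑) ⁻¹' ((↑) '' C : Set V) : Set F) = C :=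
      Set.preimage_image_eq C Subtype.val_injective
    have := h ((↑) '' C) ((isTConvex_induce_iff hsub).1 (by rwa [hpre]))
      (fun y hy => ⟨⟨y, hTF hy⟩, hTC hy, rfl⟩) x.2
    obtain ⟨y, hy, e⟩ := this
    rwa [← Subtype.ext e]

/-- A component of `F \ D` attaches to `D` in a clique, which cannot separate `F`; so that clique is
all of `D`. -/
theorem PrimeSet.subset_of_not_adj (hF : PrimeSet G F) (hD : RelConvex G F D) {u v : V}
    (hu : u ∈ D) (hv : v ∈ D) (huv : u ≠ v) (hadj : ¬ G.Adj u v) : F ⊆ D := by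
  intro w hwF
  by_contra hwD
  have hw : w ∈ F \ D := ⟨hwF, hwD⟩
  set L := comp G (F \ D) w
  have hLsub : L ⊆ F \ D := comp_subset hw
  have hQ := hD.isClique L hLsub (isConn_comp hw)
  have := hF.diff_isConn hQ L (fun x hx => ⟨(hLsub hx).1, fun h => (hLsub hx).2 h.1⟩)
    ⟨w, mem_comp_self⟩ (by
      intro x hx y hy hxy
      refine closedIn_comp x hx y ⟨hy.1, fun hyD => hy.2 ⟨hyD, x, hx, hxy⟩⟩ hxy)
  have hDQ : ∀ d ∈ D, d ∈ attach G D L := by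
    intro d hd
    by_contra hdQ
    exact (hLsub (this ⟨hD.subset hd, hdQ⟩)).2 hd
  exact hadj (hQ (hDQ u hu) (hDQ v hv) huv)

/-- A set with at least two elements that generates a prime graph contains a pair that
generates it. -/
theorem PrimeSet.exists_pair (hF : PrimeSet G F) {R : Set V} (hR : IsTHullSetOf G F R)
    (hne : R.Nontrivial) : ∃ u ∈ R, ∃ v ∈ R, u ≠ v ∧ IsTHullSetOf G F {u, v} := by
  rw [isTHullSetOf_iff] at hR
  have hpair : ∀ u ∈ R, ∀ v ∈ R, ({u, v} : Set V) ⊆ F := fun u hu v hv =>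
    (Set.insert_subset hu (Set.singleton_subset_iff.2 hv)).trans hR.1
  by_cases hcl : G.IsClique R
  · obtain ⟨u, hu, v, hv, huv⟩ := hne
    refine ⟨u, hu, v, hv, huv, isTHullSetOf_iff.2 ⟨hpair u hu v hv, fun D hD hsub => ?_⟩⟩
    have huD : u ∈ D := hsub (by simp)
    have hvD : v ∈ D := hsub (by simp)
    refine hR.2 D hD fun w hw => ?_
    by_contra hwD
    have hwu : w ≠ u := fun e => hwD (e ▸ huD)
    have hwv : w ≠ v := fun e => hwD (e ▸ hvD)
    exact huv (hD.nbr w ⟨hR.1 hw, hwD⟩ u huD v hvD (hcl hw hu hwu) (hcl hw hv hwv))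
  · rw [SimpleGraph.isClique_iff, Set.Pairwise] at hcl
    push Not at hcl
    obtain ⟨u, hu, v, hv, huv, hadj⟩ := hcl
    exact ⟨u, hu, v, hv, huv, isTHullSetOf_iff.2 ⟨hpair u hu v hv, fun D hD hsub =>
      hF.subset_of_not_adj hD (hsub (by simp)) (hsub (by simp)) huv hadj⟩⟩

theorem isTConvex_of_subsingleton (hC : C.Subsingleton) : IsTConvex G C :=
  isTConvex_of_label (fun _ => ()) (fun _ _ _ ha _ hb _ _ => hC ha hb) (fun _ _ _ _ _ => rfl)
    fun _ ha _ hb _ _ _ _ _ _ _ hab => absurd (hC ha hb) hab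

/-- The extension of a set `D ⊆ F` by all components of `G - F` attached only to `D`. -/
def extend (G : SimpleGraph V) (F D : Set V) : Set V :=
  D ∪ {x | x ∉ F ∧ attach G F (comp G Fᶜ x) ⊆ D}

/-- Each vertex outside the extension is replaced by a representative in `F \ D`. Attachments being
cliques, this keeps adjacencies to `D`, and the conditions reduce to those of `D`. -/
theorem isTConvex_extend [Finite V] (hF : Maximal (PrimeSet G) F) (hD : RelConvex G F D) :
    IsTConvex G (extend G F D) := by
  classical
  set C := extend G F D
  have hatt : ∀ x ∉ F, G.IsClique (attach G F (comp G Fᶜ x)) := fun x hx =>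
    (attach_of_mp hF ⟨x, mem_comp_self⟩ (isConn_comp (W := Fᶜ) hx) (disjoint_comp_compl hx)).1
  have hmem : ∀ x ∉ F, ∀ a ∈ F, G.Adj a x → a ∈ attach G F (comp G Fᶜ x) :=
    fun x hx a ha h => ⟨ha, x, mem_comp_self, h.symm⟩
  have hadjD : ∀ a ∈ C, ∀ x ∉ C, G.Adj a x → a ∈ D := by
    intro a ha x hx hax
    by_contra haD
    obtain ⟨haF, hasub⟩ := ha.resolve_left haD
    by_cases hxF : x ∈ F
    · exact hx (Or.inl (hasub (hmem a haF x hxF hax.symm)))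
    · refine hx (Or.inr ⟨hxF, ?_⟩)
      rwa [← comp_eq_of_adj (W := Fᶜ) haF hxF hax]
  -- The choice depends only on the attachment set, so it is constant on components of `G - F`; the
  -- default `x` is never reached where `g` matters.
  let g : Set V → V → V := fun A x => if h : (A \ D).Nonempty then h.some else x
  have hg : ∀ x ∉ C, x ∉ F → g (attach G F (comp G Fᶜ x)) x ∈ attach G F (comp G Fᶜ x) \ D := by
    intro x hx hxF
    have h : (attach G F (comp G Fᶜ x) \ D).Nonempty :=
      Set.sdiff_nonempty.2 fun h => hx (Or.inr ⟨hxF, h⟩)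
    simp only [g, dif_pos h]
    exact h.some_mem
  let r : V → V := fun x => if x ∈ F then x else g (attach G F (comp G Fᶜ x)) x
  have hrF : ∀ x ∈ F, r x = x := fun x hx => if_pos hx
  have hrN : ∀ x ∉ C, x ∉ F → r x ∈ attach G F (comp G Fᶜ x) \ D := by
    intro x hx hxF
    simp only [r, if_neg hxF]
    exact hg x hx hxF
  have hr : ∀ x ∉ C, r x ∈ F \ D := by
    intro x hx
    by_cases hxF : x ∈ F
    · rw [hrF x hxF]
      exact ⟨hxF, fun h => hx (Or.inl h)⟩
    · exact ⟨(hrN x hx hxF).1.1, (hrN x hx hxF).2⟩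
  have hra : ∀ a ∈ C, ∀ x ∉ C, G.Adj a x → G.Adj a (r x) := by
    intro a ha x hx hax
    have haD := hadjD a ha x hx hax
    by_cases hxF : x ∈ F
    · rwa [hrF x hxF]
    · refine hatt x hxF (hmem x hxF a (hD.subset haD) hax) (hrN x hx hxF).1 ?_
      exact fun e => (hrN x hx hxF).2 (e ▸ haD)
  have hmix : ∀ x ∉ C, ∀ y ∉ C, x ∈ F → y ∉ F → G.Adj x y →
      comp G (F \ D) (r x) = comp G (F \ D) (r y) := by
    intro x hx y hy hxF hyF hxy
    by_cases e : r x = r y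
    · rw [e]
    · refine comp_eq_of_adj (hr x hx) (hr y hy) ?_
      rw [hrF x hxF] at e ⊢
      exact hatt y hyF (hmem y hyF x hxF hxy) (hrN y hy hyF).1 e
  refine isTConvex_of_label (fun x => comp G (F \ D) (r x)) ?_ ?_ ?_
  · intro x hx a ha b hb hxa hxb
    exact hD.nbr (r x) (hr x hx) a (hadjD a ha x hx hxa.symm) b (hadjD b hb x hx hxb.symm)
      (hra a ha x hx hxa.symm).symm (hra b hb x hx hxb.symm).symm
  · intro x hx y hy hxy
    by_cases hxF : x ∈ F <;> by_cases hyF : y ∈ F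
    · refine comp_eq_of_adj (hr x hx) (hr y hy) ?_
      rwa [hrF x hxF, hrF y hyF]
    · exact hmix x hx y hy hxF hyF hxy
    · exact (hmix y hy x hx hyF hxF hxy.symm).symm
    · have e : comp G Fᶜ x = comp G Fᶜ y := comp_eq_of_adj (W := Fᶜ) hxF hyF hxy
      have hne : (attach G F (comp G Fᶜ y) \ D).Nonempty := ⟨_, hrN y hy hyF⟩
      simp only [r, if_neg hxF, if_neg hyF, e, g, dif_pos hne]
  · intro a ha b hb x hx y hy hax hby e hab
    refine hD.isClique (comp G (F \ D) (r x)) (comp_subset (hr x hx)) (isConn_comp (hr x hx))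
      ⟨hadjD a ha x hx hax, r x, mem_comp_self, (hra a ha x hx hax).symm⟩
      ⟨hadjD b hb y hy hby, r y, ?_, (hra b hb y hy hby).symm⟩ hab
    rw [e]
    exact mem_comp_self

end Convex

/-! ### Pivots and the two implications. -/

section Pivots

variable {G : SimpleGraph V} {S F : Set V}

theorem isSepComponent_iff {K A : Set V} : IsSepComponent G K A ↔
    IsCliqueSeparator G K ∧ ∃ a ∉ K, A = comp G Kᶜ a ∪ K := by
  refine and_congr_right fun _ => ⟨?_, ?_⟩
  · rintro ⟨H, rfl⟩
    induction H using SimpleGraph.ConnectedComponent.ind with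
    | h a => exact ⟨a, a.2, by rw [image_supp_connectedComponentMk]⟩
  · rintro ⟨a, ha, rfl⟩
    exact ⟨(G.induce Kᶜ).connectedComponentMk ⟨a, ha⟩, by rw [image_supp_connectedComponentMk]⟩

/-- An mp-subgraph between `K` and `H ∪ K` meets `F` exactly in `K`, which separates `H` from the
rest of `F`. -/
theorem isPivot_of_mem_attach [Finite V] (hF : Maximal (PrimeSet G) F) {s v : V} (hs : s ∈ S \ F)
    (hv : v ∈ attach G F (comp G Fᶜ s)) : IsPivot G S F v := by
  have hsF : s ∈ Fᶜ := hs.2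
  set H := comp G Fᶜ s
  set K := attach G F H
  have hFH : Disjoint F H := disjoint_comp_compl hs.2
  have hKF : K ⊆ F := fun _ h => h.1
  obtain ⟨hK, f, hfF, hfK⟩ := attach_of_mp hF ⟨s, mem_comp_self⟩ (isConn_comp hsF) hFH
  have hHK : Disjoint H K := (hFH.mono_left hKF).symm
  have hN : ∀ h ∈ H, ∀ y, G.Adj h y → y ∈ H ∪ K := fun h hh y hy => neighbor_comp_compl hh hy
  obtain ⟨F', hF', hKF', hF'sub, -⟩ := exists_mp_between hK ⟨s, mem_comp_self⟩
    (isConn_comp hsF) hHK hN (fun k hk => by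
      obtain ⟨h, hh, e⟩ := hk.2
      exact ⟨h, hh, e.symm⟩)
  have hint : F ∩ F' = K := by
    refine Set.Subset.antisymm (fun x hx => ?_) (Set.subset_inter hKF hKF')
    exact (hF'sub hx.2).resolve_left fun h => Set.disjoint_left.1 hFH hx.1 h
  have hsK : s ∈ Kᶜ := fun h => hs.2 (hKF h)
  have hcomp : comp G Kᶜ s = H := by
    refine Set.Subset.antisymm (comp_subset_of_closedIn mem_comp_self ?_) ?_
    · exact fun x hx y hy hxy => (hN x hx y hxy).resolve_right hy
    · refine comp_subset_of_closedIn mem_comp_self fun x hx y hy hxy => ?_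
      exact closedIn_comp x hx y (fun h => hy (hKF h)) hxy
  have hfH : f ∉ H := fun h => Set.disjoint_left.1 hFH hfF h
  refine ⟨F', isMPSubgraph_iff.2 hF', hKF hv, hKF' hv, H ∪ K, ?_, hF'sub, ?_, s, hs,
    Or.inl mem_comp_self⟩
  · rw [hint, isSepComponent_iff]
    refine ⟨⟨hK, isSeparator_iff.2 fun h => hfH ?_⟩, s, hsK, by rw [hcomp]⟩
    rw [← hcomp]
    exact isConn_iff_mem_comp.1 h s hsK f hfK
  · exact fun h => (h hfF).elim hfH hfK

theorem satisfies_of_isTHullSet [Finite V] (hS : IsTHullSet G S) (hF : Maximal (PrimeSet G) F) :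
    Satisfies G S F := by
  set R : Set V := S ∩ F ∪ {v | IsPivot G S F v}
  have hRF : R ⊆ F := by
    rintro x (hx | ⟨F', hx⟩)
    · exact hx.2
    · exact hx.2.1
  have hRh : IsTHullSetOf G F R := by
    refine isTHullSetOf_iff.2 ⟨hRF, fun D hD hRD x hx => ?_⟩
    have := isTHullSet_iff.1 hS _ (isTConvex_extend hF hD) (fun s hs => ?_) x
    · exact this.resolve_right fun h => h.1 hx
    · by_cases hsF : s ∈ F
      · exact Or.inl (hRD (Or.inl ⟨hs, hsF⟩))
      · exact Or.inr ⟨hsF, fun v hv => hRD (Or.inr (isPivot_of_mem_attach hF ⟨hs, hsF⟩ hv))⟩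
  by_cases hnt : R.Nontrivial
  · obtain ⟨u, hu, v, hv, huv, hh⟩ := hF.1.exists_pair hRh hnt
    have mixed : ∀ u v : V, u ≠ v → IsPivot G S F u → v ∈ S ∩ F → IsTHullSetOf G F {u, v} →
        Satisfies G S F := by
      rintro u v huv ⟨F', hu⟩ hv hh
      -- If `v ∈ F'`, then `v` is itself a pivot via `F'`.
      by_cases hvF' : v ∈ F'
      · exact Or.inl ⟨u, v, huv, ⟨F', hu⟩, ⟨F', hu.1, hv.2, hvF', hu.2.2.2⟩, hh⟩
      · exact Or.inr (Or.inl ⟨F', u, v, hu, ⟨hv.1, hv.2, hvF'⟩, hh⟩)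
    rcases hu with hu | hu <;> rcases hv with hv | hv
    · refine Or.inr (Or.inr (isTHullSetOf_iff.2 ⟨Set.inter_subset_right, fun D hD hSD => ?_⟩))
      exact (isTHullSetOf_iff.1 hh).2 D hD (Set.insert_subset (hSD hu)
        (Set.singleton_subset_iff.2 (hSD hv)))
    · exact mixed v u huv.symm hv hu (Set.pair_comm u v ▸ hh)
    · exact mixed u v huv hu hv hh
    · exact Or.inl ⟨u, v, huv, hu, hv, hh⟩
  · have hsub : R.Subsingleton := Set.not_nontrivial_iff.1 hnt
    have hFR : F ⊆ R := (isTHullSetOf_iff.1 hRh).2 R (by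
      have := (isTConvex_of_subsingleton (G := G) hsub).relConvex_inter F
      rwa [Set.inter_eq_left.2 hRF] at this) subset_rfl
    refine Or.inr (Or.inr (isTHullSetOf_iff.2 ⟨Set.inter_subset_right, fun D _ hSD x hx => ?_⟩))
    -- Here `F` has at most one vertex; were it a pivot via `F'`, then `F ⊆ F' ⊆ A`.
    rcases hFR hx with h | ⟨F', hF', -, hxF', A, -, hF'A, hFA, -⟩
    · exact hSD h
    · refine absurd (fun y hy => hF'A ?_) hFA
      rwa [hsub (hFR hy) (hFR hx)]

theorem isTHullSet_of_satisfies [Finite V]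
    (h : ∀ F, Maximal (PrimeSet G) F → Satisfies G S F) : IsTHullSet G S := by
  refine isTHullSet_iff.2 fun C hC hSC w => ?_
  by_contra hw
  have hwC : w ∈ Cᶜ := hw
  set L := comp G Cᶜ w
  set Q := attach G C L
  have hQC : Q ⊆ C := fun _ h => h.1
  have hCL : Disjoint C L := disjoint_comp_compl hw
  have hLc : IsConn G L := isConn_comp hwC
  have hQ : G.IsClique Q := hC.isClique_attach hLc hCL.symm
  have hN : ∀ l ∈ L, ∀ y, G.Adj l y → y ∈ L ∪ Q := fun l hl y hy => neighbor_comp_compl hl hy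
  have hLQ : Disjoint L Q := (hCL.mono_left hQC).symm
  obtain ⟨F, hF, hQF, hFsub, z, hzF, hzL⟩ := exists_mp_between hQ ⟨w, mem_comp_self⟩ hLc
    hLQ hN (fun k hk => by
      obtain ⟨h, hh, e⟩ := hk.2
      exact ⟨h, hh, e.symm⟩)
  have hno : ∀ T ⊆ C, ¬ IsTHullSetOf G F T := by
    intro T hTC hT
    rw [isTHullSetOf_iff] at hT
    have := hT.2 _ (hC.relConvex_inter F) (Set.subset_inter hTC hT.1) hzF
    exact Set.disjoint_left.1 hCL this.1 hzL
  -- The component `H` holding `s` avoids `F`, hence cannot pass through `Q` into `L`. If `v ∈ L`,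
  -- then `F' ⊆ L ∪ Q`, so `F' ⊆ F`, and maximality gives `F ⊆ F'`, a contradiction.
  have hpiv : ∀ v, IsPivot G S F v → v ∈ C := by
    rintro v ⟨F', hF', hvF, hvF', A, hA, hF'A, hFA, s, hs, hsA⟩
    rw [isMPSubgraph_iff] at hF'
    rw [isSepComponent_iff] at hA
    obtain ⟨⟨hK, -⟩, a, ha, rfl⟩ := hA
    set K := F ∩ F'
    have haK : a ∈ Kᶜ := ha
    set H := comp G Kᶜ a
    have hHK : Disjoint H K := (disjoint_comp_compl ha).symm
    have hFH : ∀ x ∈ H, x ∉ F := by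
      intro x hx hxF
      refine hFA (hF.1.subset_union hK ⟨x, hxF, hx⟩ hHK fun y hy t hyt => ?_)
      exact (neighbor_comp_compl hy hyt).imp id fun h => h.1
    have hsH : s ∈ H := hsA.resolve_right fun h => hs.2 h.1
    have hsL : s ∉ L := fun h => Set.disjoint_left.1 hCL (hSC hs.1) h
    have hHL : ∀ x ∈ H, x ∉ L := by
      intro x hx hxL
      refine hsL (isConn_comp haK (H ∩ L) Set.inter_subset_left ⟨x, hx, hxL⟩ ?_ hsH).2
      intro l hl y hy hly
      exact ⟨hy, (hN l hl.2 y hly).resolve_right fun hyQ => hFH y hy (hQF hyQ)⟩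
    by_contra hvC
    have hvL : v ∈ L := (hFsub hvF).resolve_right fun h => hvC (hQC h)
    have hF'LQ : F' ⊆ L ∪ Q := hF'.1.subset_union hQ ⟨v, hvF', hvL⟩ hLQ hN
    have hF'F : F' ⊆ F := by
      intro x hx
      rcases hF'A hx with hxH | hxK
      · exact (hF'LQ hx).elim (fun h => absurd h (hHL x hxH)) fun h => hQF h
      · exact hxK.1
    exact hFA ((hF'.2 hF.1 hF'F).trans hF'A)
  rcases h F hF with ⟨u, v, -, hu, hv, hh⟩ | ⟨F', u, v, hu, hv, hh⟩ | hh
  · exact hno _ (Set.insert_subset (hpiv u hu) (Set.singleton_subset_iff.2 (hpiv v hv))) hh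
  · exact hno _ (Set.insert_subset (hpiv u ⟨F', hu⟩) (Set.singleton_subset_iff.2 (hSC hv.1))) hh
  · exact hno _ (Set.inter_subset_left.trans hSC) hh

theorem two_le_ncard_of_isTHullSet [Finite V] (hG : IsReducible G) (hS : IsTHullSet G S) :
    2 ≤ S.ncard := by
  by_contra hlt
  have hsub : S.Subsingleton := Set.ncard_le_one_iff_subsingleton.1 (by omega)
  obtain ⟨K, -, a, b, hab⟩ := hG
  have hall := isTHullSet_iff.1 hS S (isTConvex_of_subsingleton hsub) subset_rfl
  have e : a = b := Subtype.ext (hsub (hall a) (hall b))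
  exact hab (e ▸ SimpleGraph.Reachable.refl a)

end Pivots

end TConv

theorem mainTheorem2 {V : Type*} [Finite V] (G : SimpleGraph V)
    (hG : TConv.IsReducible G) (S : Set V) :
    TConv.IsTHullSet G S ↔
      2 ≤ S.ncard ∧ ∀ F : Set V, TConv.IsMPSubgraph G F → TConv.Satisfies G S F := by
  refine ⟨fun h => ⟨TConv.two_le_ncard_of_isTHullSet hG h, fun F hF => ?_⟩, fun h => ?_⟩
  · exact TConv.satisfies_of_isTHullSet h (TConv.isMPSubgraph_iff.1 hF)
  · exact TConv.isTHullSet_of_satisfies fun F hF => h.2 F (TConv.isMPSubgraph_iff.2 hF)
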